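/- Let $G$ be a finite simple graph without isolated vertices, and let $\mathcal A$ be its set of arcs (ordered pairs $a=(x,y)$ of adjacent vertices, with origin $o(a)=x$, terminus $t(a)=y$ and inverse $a^{-1}=(y,x)$). Let $d\in\mathbb C^{V(G)\times\mathcal A}$ be given by $d_{xa}=\frac{1}{\sqrt{\deg x}}\,\delta_{x,t(a)}$, let $S\in\mathbb C^{\mathcal A\times\mathcal A}$ be given by $S_{ab}=\delta_{a,b^{-1}}$, and let $U=S(2d^*d-I)$ be the time evolution matrix of the Grover walk on $G$. A state is a vector $\Phi\in\mathbb C^{\mathcal A}$ with $\langle\Phi,\Phi\rangle=1$. Perfect state transfer occurs from a state $\Phi$ to another state $\Psi\neq\Phi$ at time $\tau\in\{1,2,\dots\}$ if $U^\tau\Phi=\gamma\Psi$ for some $\gamma\in\mathbb C$ with $|\gamma|=1$. The vertex type states are the vectors $d^*\mathbf e_u$ with $u\in V(G)$, where $\mathbf e_u$ is the standard unit vector at $u$; $G$ exhibits perfect state transfer if perfect state transfer occurs, at some time, between two distinct vertex type states, and transfer from the vertex $u$ to the vertex $v$ means transfer from $d^*\mathbf e_u$ to $d^*\mathbf e_v$.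 For $n\ge 2$, let $\operatorname{UC}(n)$ be the unitary Cayley graph: its vertex set is $\mathbb Z_n$, and $u,v$ are adjacent if and only if $\gcd(u-v,n)=1$. **Theorem.** For every integer $n\ge 2$, the graph $\operatorname{UC}(n)$ exhibits perfect state transfer if and only if $n\in\{2,4,6,12\}$. Here $\operatorname{UC}(2)\cong K_2$, $\operatorname{UC}(4)\cong C_4$ and $\operatorname{UC}(6)\cong C_6$. Moreover, in $\operatorname{UC}(12)$ perfect state transfer occurs from a vertex $u$ to a vertex $v$ at time $\tau$ if and only if $v=u+6$ and $\tau\equiv 6\pmod{12}$; in particular it occurs from every vertex $u$ to $u+6$ at time $6$, and $6$ is the first time at which it occurs. -/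

import Mathlib

open scoped Matrix

namespace GroverWalk

section Walk

variable {V : Type*} [Fintype V] [DecidableEq V] (G : SimpleGraph V) [DecidableRel G.Adj]

/-- The boundary matrix `d`, with `d x a = 1 / √(deg x)` if `x` is the terminus of the arc `a`, and
`0` otherwise. The arcs of `G` are its darts; a dart has origin `a.fst` and terminus `a.snd`. -/
noncomputable def boundary : Matrix V G.Dart ℂ :=
  Matrix.of fun x a => if x = a.snd then ((1 / Real.sqrt (G.degree x) : ℝ) : ℂ) else 0

/-- The shift matrix `S`, with `S a b = 1` if `a` is the inverse arc of `b`, and `0` otherwise. -/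
def shift : Matrix G.Dart G.Dart ℂ :=
  Matrix.of fun a b => if a = b.symm then 1 else 0

/-- The time evolution matrix `U = S (2 d* d - I)` of the Grover walk. -/
noncomputable def evolution : Matrix G.Dart G.Dart ℂ :=
  shift G * ((2 : ℂ) • ((boundary G)ᴴ * boundary G) - 1)

/-- A vector on the arcs is a state if its Euclidean inner product with itself is `1`. -/
def IsState (Φ : G.Dart → ℂ) : Prop :=
  star Φ ⬝ᵥ Φ = 1

/-- The vector `d* e_u` on the arcs. -/
noncomputable def vertexVec (u : V) : G.Dart → ℂ :=
  (boundary G)ᴴ *ᵥ Pi.single u 1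

/-- A state is of vertex type if it equals `d* e_u` for some vertex `u`. -/
def IsVertexState (Φ : G.Dart → ℂ) : Prop :=
  IsState G Φ ∧ ∃ u : V, Φ = vertexVec G u

/-- Perfect state transfer from the state `Φ` to another state `Ψ` at the positive integer
time `τ`: `U ^ τ Φ = γ Ψ` for some unimodular complex number `γ`. -/
def StateTransfer (Φ Ψ : G.Dart → ℂ) (τ : ℕ) : Prop :=
  IsState G Φ ∧ IsState G Ψ ∧ Φ ≠ Ψ ∧ 0 < τ ∧
    ∃ γ : ℂ, ‖γ‖ = 1 ∧ (evolution G ^ τ) *ᵥ Φ = γ • Ψ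

/-- Perfect state transfer from the vertex `u` to the vertex `v` at time `τ`. -/
def VertexTransfer (u v : V) (τ : ℕ) : Prop :=
  StateTransfer G (vertexVec G u) (vertexVec G v) τ

/-- A graph exhibits perfect state transfer if perfect state transfer occurs at some time between
two distinct vertex type states. -/
def ExhibitsPST : Prop :=
  ∃ Φ Ψ : G.Dart → ℂ, IsVertexState G Φ ∧ IsVertexState G Ψ ∧ Φ ≠ Ψ ∧
    ∃ τ : ℕ, StateTransfer G Φ Ψ τ

end Walk

/-- The connection set of all residues modulo `n` that are coprime to `n`. -/
def unitSet (n : ℕ) : Set (ZMod n) :=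
  {a | Nat.gcd a.val n = 1}

instance (n : ℕ) : DecidablePred (· ∈ unitSet n) :=
  fun a => inferInstanceAs (Decidable (Nat.gcd a.val n = 1))

/-- The unitary Cayley graph `UC(n)`: the Cayley graph of the additive group of integers modulo `n`
whose connection set consists of the residues coprime to `n`. -/
def UC (n : ℕ) : SimpleGraph (ZMod n) :=
  SimpleGraph.addCayley (unitSet n)

instance (n : ℕ) [NeZero n] : DecidableRel (UC n).Adj :=
  inferInstanceAs (DecidableRel (SimpleGraph.addCayley (unitSet n)).Adj)

end GroverWalk

/-!
Write `P = d S d*` for the discriminant; on a `k`-regular graph it is the adjacency matrix divided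
by `k`. Since `U d* = S d*` and `U S d* = 2 S d* P - d*`, the matrices `d U ^ τ d*` satisfy the
Chebyshev recurrence, so `d U ^ τ d* = T_τ(P)` (`boundary_mul_evolution_pow`). As `U` is unitary and
`d*` is an isometry, transfer from `u` to `v` at time `τ` amounts to `T_τ(P) e_u = γ e_v`, and pairing
with the constant eigenvector gives `γ = 1`.

On `UC n` the additive characters of `ZMod n` are eigenvectors of `P`, with the normalized Ramanujan
sums `λ_c` (`charEigenvalue`) as eigenvalues. With `w = v - u`, transfer gives
`T_τ(λ_c) = e(c w / n)` for all `c` (`VertexTransfer.eval_charEigenvalue`). This restricts `n`: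

* `λ_c = λ_{-c}` forces `2 w = 0`, hence `n` is even, `T_τ(λ_1) = -1` and `T_τ(λ_2) = 1`;
* if `8 ∣ n` or `9 ∣ n`, then `n / 4` or `n / 3` is a nilpotent residue that does not vanish when
  doubled, which gives `λ_1 = λ_2 = 0`, a contradiction;
* for a prime `p ∣ n` we have `λ_{n/p} = -1 / (p - 1)` and `T_τ(λ_{n/p}) = ± 1`. The latter makes
  `2 λ_{n/p}` a sum of two roots of unity, hence an integer, as it is rational; so `p ≤ 3`.

Thus `n` is an even divisor of `12`. Conversely, for these `n` the vectors `T_s(P) e_0` are written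
down explicitly up to the time of transfer. For `n = 12`, the conditions `T_τ(0) = -1` (from `λ_1`)
and `T_τ(-1/2) = 1` (from `λ_4`) give `τ ≡ 6` modulo `12`, and two transfers at time `6` show that
`U ^ 12` fixes every vertex state.
-/

namespace GroverWalk

open Polynomial Finset

/-! ### The boundary and shift matrices -/

section Shift

variable {V : Type*} [DecidableEq V] (G : SimpleGraph V)

lemma transpose_shift : (shift G)ᵀ = shift G := by
  ext a b
  have h : b = a.symm ↔ a = b.symm :=
    ⟨fun h => by rw [h, SimpleGraph.Dart.symm_symm], fun h => by rw [h, SimpleGraph.Dart.symm_symm]⟩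
  simp [shift, h]

lemma conjTranspose_shift : (shift G)ᴴ = shift G := by
  rw [Matrix.conjTranspose, transpose_shift]
  ext a b
  simp [shift]

end Shift

section Walk

variable {V : Type*} [Fintype V] [DecidableEq V] (G : SimpleGraph V) [DecidableRel G.Adj]

lemma sum_dart_snd_eq (x : V) (h : V → ℂ) :
    ∑ a : G.Dart, (if x = a.snd then h a.fst else 0) = ∑ y ∈ G.neighborFinset x, h y := by
  rw [← Finset.sum_filter]
  refine Finset.sum_nbij (fun a => a.fst) ?_ ?_ ?_ fun _ _ => rfl
  · intro a ha
    obtain rfl : x = a.snd := (Finset.mem_filter.1 ha).2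
    simpa using a.adj.symm
  · intro a ha b hb hab
    have ha' : x = a.snd := by simpa using ha
    have hb' : x = b.snd := by simpa using hb
    exact SimpleGraph.Dart.ext _ _ (Prod.ext hab (ha'.symm.trans hb'))
  · intro y hy
    have hy' : G.Adj x y := by simpa using hy
    exact ⟨⟨(y, x), hy'.symm⟩, by simp, rfl⟩

lemma conjTranspose_boundary_mulVec (f : V → ℂ) (a : G.Dart) :
    ((boundary G)ᴴ *ᵥ f) a = ((1 / Real.sqrt (G.degree a.snd) : ℝ) : ℂ) * f a.snd := by
  simp [Matrix.mulVec, dotProduct, boundary, Matrix.conjTranspose_apply, apply_ite star]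

lemma boundary_mulVec (φ : G.Dart → ℂ) (x : V) :
    (boundary G *ᵥ φ) x =
      ((1 / Real.sqrt (G.degree x) : ℝ) : ℂ) * ∑ a : G.Dart, if x = a.snd then φ a else 0 := by
  simp only [Matrix.mulVec, dotProduct, boundary, Matrix.of_apply, ite_mul, zero_mul,
    Finset.mul_sum, mul_ite, mul_zero]

lemma shift_mulVec (φ : G.Dart → ℂ) (a : G.Dart) : (shift G *ᵥ φ) a = φ a.symm := by
  have h : ∀ b : G.Dart, a = b.symm ↔ a.symm = b := fun b =>
    ⟨fun h => by rw [h, SimpleGraph.Dart.symm_symm], fun h => by rw [← h, SimpleGraph.Dart.symm_symm]⟩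
  simp [Matrix.mulVec, dotProduct, shift, h]

lemma shift_mul_shift : shift G * shift G = 1 := by
  refine Matrix.ext_of_mulVec_single fun a => ?_
  ext b
  rw [← Matrix.mulVec_mulVec, shift_mulVec, shift_mulVec, SimpleGraph.Dart.symm_symm,
    Matrix.one_mulVec]

variable {G}

lemma ofReal_one_div_sqrt_mul_self (k : ℕ) :
    ((1 / Real.sqrt k : ℝ) : ℂ) * ((1 / Real.sqrt k : ℝ) : ℂ) = (k : ℂ)⁻¹ := by
  rw [← Complex.ofReal_mul, div_mul_div_comm, Real.mul_self_sqrt k.cast_nonneg]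
  simp

/-- The matrix `d*` is an isometry from functions on the vertices to functions on the arcs. -/
lemma boundary_mul_conjTranspose (hG : ∀ x, 0 < G.degree x) :
    boundary G * (boundary G)ᴴ = 1 := by
  refine Matrix.ext_of_mulVec_single fun u => ?_
  ext x
  have h : ∀ a : G.Dart, (if x = a.snd then
      ((boundary G)ᴴ *ᵥ Pi.single u 1) a else 0) = if x = a.snd then
      ((1 / Real.sqrt (G.degree x) : ℝ) : ℂ) * (Pi.single u 1 : V → ℂ) x else 0 := by
    intro a
    split_ifs with hx
    · rw [conjTranspose_boundary_mulVec, hx]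
    · rfl
  have hk : (G.degree x : ℂ) ≠ 0 := by exact_mod_cast (hG x).ne'
  rw [← Matrix.mulVec_mulVec, boundary_mulVec, Finset.sum_congr rfl fun a _ => h a,
    sum_dart_snd_eq G x (fun _ => _), Finset.sum_const, SimpleGraph.card_neighborFinset_eq_degree,
    nsmul_eq_mul, Matrix.one_mulVec, mul_left_comm, ← mul_assoc (Complex.ofReal _),
    ofReal_one_div_sqrt_mul_self, mul_inv_cancel_left₀ hk]

/-! ### The discriminant and the Chebyshev recurrence -/

variable (G) in
/-- The discriminant `P = d S d*` of the Grover walk, which is the adjacency matrix with its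
entry at `(x, y)` divided by `√(deg x * deg y)`. -/
noncomputable def discriminant : Matrix V V ℂ :=
  boundary G * shift G * (boundary G)ᴴ

lemma discriminant_mulVec {k : ℕ} (hG : G.IsRegularOfDegree k) (f : V → ℂ) (x : V) :
    (discriminant G *ᵥ f) x = (k : ℂ)⁻¹ * ∑ y ∈ G.neighborFinset x, f y := by
  have h : ∀ a : G.Dart, (if x = a.snd then
      (shift G *ᵥ ((boundary G)ᴴ *ᵥ f)) a else 0) = if x = a.snd then
      ((1 / Real.sqrt k : ℝ) : ℂ) * f a.fst else 0 := by
    intro a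
    rw [shift_mulVec, conjTranspose_boundary_mulVec, hG]
    rfl
  rw [discriminant, ← Matrix.mulVec_mulVec, ← Matrix.mulVec_mulVec, boundary_mulVec,
    Finset.sum_congr rfl fun a _ => h a,
    sum_dart_snd_eq G x fun y => ((1 / Real.sqrt k : ℝ) : ℂ) * f y, ← Finset.mul_sum, ← mul_assoc,
    hG, ofReal_one_div_sqrt_mul_self]

lemma transpose_discriminant : (discriminant G)ᵀ = discriminant G := by
  have h : (boundary G)ᴴ = (boundary G)ᵀ := by
    ext a x
    simp [boundary, Matrix.conjTranspose_apply, apply_ite star]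
  rw [discriminant, h, Matrix.transpose_mul, Matrix.transpose_mul, transpose_shift,
    Matrix.transpose_transpose, Matrix.mul_assoc]

lemma evolution_mul_conjTranspose_boundary (hG : ∀ x, 0 < G.degree x) :
    evolution G * (boundary G)ᴴ = shift G * (boundary G)ᴴ := by
  rw [evolution, Matrix.mul_assoc, Matrix.sub_mul, Matrix.smul_mul, Matrix.mul_assoc,
    boundary_mul_conjTranspose hG, Matrix.mul_one, Matrix.one_mul, two_smul, add_sub_cancel_right]

/-- `U S d* = 2 S d* P - d*`: on the range of `(d*, S d*)` the walk is a two-term recurrence. -/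
lemma evolution_mul_shift_mul_conjTranspose_boundary :
    evolution G * (shift G * (boundary G)ᴴ) =
      (2 : ℂ) • (shift G * (boundary G)ᴴ * discriminant G) - (boundary G)ᴴ := by
  have h := shift_mul_shift G
  rw [evolution, Matrix.mul_sub, Matrix.mul_one, Matrix.sub_mul, ← Matrix.mul_assoc (shift G)
    (shift G), h, Matrix.one_mul, Matrix.mul_smul, Matrix.smul_mul, discriminant]
  simp only [Matrix.mul_assoc]

lemma evolution_pow_add_two_mul (hG : ∀ x, 0 < G.degree x) (s : ℕ) :
    evolution G ^ (s + 2) * (boundary G)ᴴ =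
      (2 : ℂ) • (evolution G ^ (s + 1) * (boundary G)ᴴ * discriminant G) -
        evolution G ^ s * (boundary G)ᴴ := by
  have h2 : evolution G ^ (s + 2) = evolution G ^ s * (evolution G * evolution G) := by
    rw [pow_add, pow_two]
  rw [h2, pow_succ, Matrix.mul_assoc, Matrix.mul_assoc (evolution G),
    evolution_mul_conjTranspose_boundary hG, evolution_mul_shift_mul_conjTranspose_boundary,
    Matrix.mul_sub, Matrix.mul_smul, Matrix.mul_assoc (_ ^ s) (evolution G),
    evolution_mul_conjTranspose_boundary hG]
  simp only [Matrix.mul_assoc]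

/-- Compressed to the vertices, the `τ`-th power of the walk is the Chebyshev polynomial `T_τ` of
the discriminant. The next value is carried along for the induction. -/
lemma boundary_mul_evolution_pow (hG : ∀ x, 0 < G.degree x) (τ : ℕ) :
    boundary G * (evolution G ^ τ * (boundary G)ᴴ) =
        aeval (discriminant G) (Chebyshev.T ℂ τ) ∧
      boundary G * (evolution G ^ (τ + 1) * (boundary G)ᴴ) =
        aeval (discriminant G) (Chebyshev.T ℂ (τ + 1)) := by
  induction τ with
  | zero =>
    refine ⟨by simp [boundary_mul_conjTranspose hG], ?_⟩
    rw [zero_add, pow_one, evolution_mul_conjTranspose_boundary hG]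
    simp [discriminant, Matrix.mul_assoc]
  | succ s ih =>
    refine ⟨by exact_mod_cast ih.2, ?_⟩
    rw [evolution_pow_add_two_mul hG, Matrix.mul_sub, ih.1, Matrix.mul_smul, ← Matrix.mul_assoc,
      ih.2]
    have h : ((s + 1 : ℕ) : ℤ) + 1 = (s : ℤ) + 2 := by push_cast; ring
    rw [h, Chebyshev.T_add_two, map_sub, mul_comm (2 * X) (Chebyshev.T ℂ _), map_mul, map_mul,
      aeval_X, map_ofNat]
    congr 1
    rw [two_smul, two_mul, mul_add]

lemma conjTranspose_evolution_mul_self (hG : ∀ x, 0 < G.degree x) :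
    (evolution G)ᴴ * evolution G = 1 := by
  have h := boundary_mul_conjTranspose hG
  set Q := (boundary G)ᴴ * boundary G with hQ
  have hQ2 : Q * Q = Q := by
    rw [hQ, Matrix.mul_assoc, ← Matrix.mul_assoc (boundary G), h, Matrix.one_mul]
  have hQs : Qᴴ = Q := by simp [hQ]
  have hU : (evolution G)ᴴ = ((2 : ℂ) • Q - 1) * shift G := by
    simp [evolution, Matrix.conjTranspose_mul, conjTranspose_shift, ← hQ, hQs]
  rw [hU, evolution, ← hQ, Matrix.mul_assoc, ← Matrix.mul_assoc (shift G), shift_mul_shift,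
    Matrix.one_mul]
  simp only [two_smul, mul_sub, sub_mul, mul_add, add_mul, hQ2, mul_one, one_mul]
  abel

lemma conjTranspose_evolution_pow_mul_self (hG : ∀ x, 0 < G.degree x) (s : ℕ) :
    (evolution G ^ s)ᴴ * evolution G ^ s = 1 := by
  induction s with
  | zero => simp
  | succ s ih =>
    rw [pow_succ, Matrix.conjTranspose_mul, Matrix.mul_assoc, ← Matrix.mul_assoc (_ᴴ) (_ ^ s), ih,
      Matrix.one_mul, conjTranspose_evolution_mul_self hG]

/-! ### Transfer between vertex states -/

lemma star_vertexVec_dotProduct (u : V) (φ : G.Dart → ℂ) :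
    star (vertexVec G u) ⬝ᵥ φ = (boundary G *ᵥ φ) u := by
  rw [vertexVec, Matrix.star_mulVec, Matrix.conjTranspose_conjTranspose, ← Matrix.dotProduct_mulVec,
    ← Pi.single_star]
  simp

lemma boundary_mulVec_vertexVec (hG : ∀ x, 0 < G.degree x) (u : V) :
    boundary G *ᵥ vertexVec G u = Pi.single u 1 := by
  rw [vertexVec, Matrix.mulVec_mulVec, boundary_mul_conjTranspose hG, Matrix.one_mulVec]

lemma isState_vertexVec (hG : ∀ x, 0 < G.degree x) (u : V) : IsState G (vertexVec G u) := by
  rw [IsState, star_vertexVec_dotProduct, boundary_mulVec_vertexVec hG, Pi.single_eq_same]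

lemma vertexVec_injective (hG : ∀ x, 0 < G.degree x) : Function.Injective (vertexVec G) := by
  intro u v h
  have h' := congrArg (fun φ => (boundary G *ᵥ φ) u) h
  simp only [boundary_mulVec_vertexVec hG, Pi.single_eq_same] at h'
  by_contra huv
  rw [Pi.single_eq_of_ne huv] at h'
  exact one_ne_zero h'

lemma boundary_mulVec_evolution_pow_vertexVec (hG : ∀ x, 0 < G.degree x) (u : V) (τ : ℕ) :
    boundary G *ᵥ (evolution G ^ τ *ᵥ vertexVec G u) =
      aeval (discriminant G) (Chebyshev.T ℂ τ) *ᵥ Pi.single u 1 := by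
  rw [vertexVec, Matrix.mulVec_mulVec, Matrix.mulVec_mulVec, Matrix.mul_assoc,
    (boundary_mul_evolution_pow hG τ).1]

open scoped ComplexOrder in
/-- If the compression of `U ^ τ` to the vertices maps `e_u` to `e_v`, then `U ^ τ` maps `d* e_u` to
`d* e_v`: the projection of the unit vector `U ^ τ d* e_u` already has norm one. -/
lemma evolution_pow_mulVec_vertexVec (hG : ∀ x, 0 < G.degree x) {u v : V} {τ : ℕ}
    (h : aeval (discriminant G) (Chebyshev.T ℂ τ) *ᵥ Pi.single u 1 = Pi.single v 1) :
    evolution G ^ τ *ᵥ vertexVec G u = vertexVec G v := by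
  set x := evolution G ^ τ *ᵥ vertexVec G u with hx
  set y := vertexVec G v with hy
  have hxx : star x ⬝ᵥ x = 1 := by
    rw [hx, Matrix.star_mulVec, ← Matrix.dotProduct_mulVec, Matrix.mulVec_mulVec,
      conjTranspose_evolution_pow_mul_self hG, Matrix.one_mulVec]
    exact isState_vertexVec hG u
  have hyx : star y ⬝ᵥ x = 1 := by
    rw [hy, star_vertexVec_dotProduct, hx, boundary_mulVec_evolution_pow_vertexVec hG, h,
      Pi.single_eq_same]
  have hxy : star x ⬝ᵥ y = 1 := by
    have := congrArg star hyx
    rwa [Matrix.star_dotProduct, star_star, star_one] at this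
  have hyy : star y ⬝ᵥ y = 1 := isState_vertexVec hG v
  rw [← sub_eq_zero, ← dotProduct_star_self_eq_zero, star_sub, sub_dotProduct,
    dotProduct_sub, dotProduct_sub, hxx, hyx, hxy, hyy]
  ring

lemma vecMul_aeval_of_eigenvector {A : Matrix V V ℂ} {f : V → ℂ} {μ : ℂ} (h : f ᵥ* A = μ • f)
    (p : ℂ[X]) : f ᵥ* aeval A p = p.eval μ • f := by
  induction p using Polynomial.induction_on' with
  | add p q hp hq => rw [map_add, Matrix.vecMul_add, hp, hq, eval_add, add_smul]
  | monomial m c =>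
    rw [aeval_monomial, eval_monomial, Algebra.algebraMap_eq_smul_one, smul_mul_assoc, one_mul,
      Matrix.vecMul_smul, mul_smul]
    congr 1
    induction m with
    | zero => simp
    | succ m ih => rw [pow_succ, ← Matrix.vecMul_vecMul, ih, Matrix.smul_vecMul, h, smul_smul,
        pow_succ]

lemma discriminant_mulVec_one {k : ℕ} (hk : 0 < k) (hG : G.IsRegularOfDegree k) :
    discriminant G *ᵥ 1 = 1 := by
  ext x
  have hk' : (k : ℂ) ≠ 0 := by exact_mod_cast hk.ne'
  simp [discriminant_mulVec hG, hG x, hk']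

/-- Pairing `T_τ(P) e_u = γ e_v` with an eigenvector `f` of the symmetric matrix `P`. The constant
eigenvector, with eigenvalue `1`, forces the phase `γ` to be `1`. -/
lemma VertexTransfer.eval_mul_eq {k : ℕ} (hk : 0 < k) (hG : G.IsRegularOfDegree k) {u v : V} {τ : ℕ}
    (h : VertexTransfer G u v τ) {f : V → ℂ} {μ : ℂ} (hf : discriminant G *ᵥ f = μ • f) :
    (Chebyshev.T ℂ τ).eval μ * f u = f v := by
  obtain ⟨-, -, -, -, γ, -, hγ⟩ := h
  have hpos : ∀ x, 0 < G.degree x := fun x => by rwa [hG x]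
  have hM := congrArg (boundary G *ᵥ ·) hγ
  simp only [boundary_mulVec_evolution_pow_vertexVec hpos, Matrix.mulVec_smul,
    boundary_mulVec_vertexVec hpos] at hM
  have key : ∀ (g : V → ℂ) (ν : ℂ), discriminant G *ᵥ g = ν • g →
      (Chebyshev.T ℂ τ).eval ν * g u = γ * g v := by
    intro g ν hg
    rw [← transpose_discriminant, Matrix.mulVec_transpose] at hg
    have := congrArg (g ⬝ᵥ ·) hM
    simp only [Matrix.dotProduct_mulVec, vecMul_aeval_of_eigenvector hg] at this
    simpa using this
  have hone := key 1 1 (by rw [discriminant_mulVec_one hk hG, one_smul])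
  rw [Chebyshev.T_eval_one] at hone
  have hγ1 : γ = 1 := by simpa using hone.symm
  rw [key f μ hf, hγ1, one_mul]

/-- A solution of the Chebyshev recurrence for `P` computes `T_τ(P)` on its initial value. -/
lemma aeval_T_mulVec_of_recurrence {A : Matrix V V ℂ} {F : ℕ → V → ℂ} {τ : ℕ}
    (h1 : 0 < τ → F 1 = A *ᵥ F 0)
    (h2 : ∀ s, s + 2 ≤ τ → F (s + 2) = (2 : ℂ) • (A *ᵥ F (s + 1)) - F s) :
    aeval A (Chebyshev.T ℂ τ) *ᵥ F 0 = F τ := by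
  suffices ∀ s ≤ τ, aeval A (Chebyshev.T ℂ s) *ᵥ F 0 = F s from this τ le_rfl
  intro s
  induction s using Nat.strong_induction_on with
  | _ s ih =>
    intro hs
    match s with
    | 0 => simp
    | 1 => simp [h1 hs]
    | s + 2 =>
      have h : ((s + 2 : ℕ) : ℤ) = (s : ℤ) + 2 := by push_cast; ring
      have ih1 := ih (s + 1) (by omega) (by omega)
      push_cast at ih1
      rw [h2 s hs, ← ih s (by omega) (by omega), ← ih1, h, Chebyshev.T_add_two, map_sub, map_mul,
        map_mul, aeval_X, map_ofNat, Matrix.sub_mulVec, Matrix.mulVec_mulVec, two_smul, two_mul,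
        add_mul, Matrix.add_mulVec]

/-- For `x = cos θ` the hypothesis is `cos (τ θ) = ± 1`, so `2 x = exp (i θ) + exp (-i θ)` is a sum of
two `2 τ`-th roots of unity. -/
lemma isIntegral_two_mul_of_T_eval_sq {τ : ℕ} (hτ : 0 < τ) {x : ℂ}
    (h : (Chebyshev.T ℂ τ).eval x ^ 2 = 1) : IsIntegral ℤ (2 * x) := by
  obtain ⟨θ, rfl⟩ := Complex.cos_surjective x
  rw [Chebyshev.T_complex_cos] at h
  have hsin : Complex.sin ((τ : ℤ) * θ) = 0 := by
    have := Complex.sin_sq_add_cos_sq ((τ : ℤ) * θ)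
    rw [h, add_eq_right] at this
    exact pow_eq_zero_iff two_ne_zero |>.1 this
  have hpow : Complex.exp (θ * Complex.I) ^ (τ * 2) = 1 := by
    rw [pow_mul, ← Complex.exp_nat_mul, ← mul_assoc]
    have h0 : Complex.exp ((τ : ℂ) * θ * Complex.I) = Complex.cos ((τ : ℤ) * θ) := by
      rw [Complex.exp_mul_I]
      push_cast at hsin ⊢
      rw [hsin, zero_mul, add_zero]
    rw [h0, h]
  have hpow' : Complex.exp (-θ * Complex.I) ^ (τ * 2) = 1 := by
    rw [neg_mul, Complex.exp_neg, inv_pow, hpow, inv_one]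
  rw [Complex.two_cos]
  exact (IsIntegral.of_pow (by omega) (hpow ▸ isIntegral_one)).add
    (IsIntegral.of_pow (by omega) (hpow' ▸ isIntegral_one))

end Walk

/-! ### Characters of the unitary Cayley graph -/

section UnitaryCayley

lemma mem_unitSet_iff {n : ℕ} [NeZero n] (a : ZMod n) : a ∈ unitSet n ↔ IsUnit a := by
  rw [← ZMod.natCast_zmod_val a, ZMod.isUnit_iff_coprime, ZMod.natCast_zmod_val]
  rfl

variable {n : ℕ} [NeZero n]

variable (n) in
/-- The connection set of `UC n` as a finite set. -/
def unitFinset : Finset (ZMod n) :=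
  univ.filter (· ∈ unitSet n)

lemma mem_unitFinset {a : ZMod n} : a ∈ unitFinset n ↔ IsUnit a := by
  simp [unitFinset, mem_unitSet_iff]

lemma card_unitFinset_pos : 0 < #(unitFinset n) :=
  card_pos.2 ⟨1, mem_unitFinset.2 isUnit_one⟩

lemma UC_adj (hn : 2 ≤ n) (x y : ZMod n) : (UC n).Adj x y ↔ IsUnit (y - x) := by
  have : Fact (1 < n) := ⟨hn⟩
  rw [UC, SimpleGraph.addCayley_adj']
  constructor
  · rintro ⟨-, g, hg, rfl | rfl⟩
    · rwa [add_sub_cancel_left, ← mem_unitSet_iff]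
    · rw [sub_add_cancel_left]
      exact ((mem_unitSet_iff g).1 hg).neg
  · intro h
    refine ⟨?_, y - x, (mem_unitSet_iff _).2 h, Or.inl (by ring)⟩
    rintro rfl
    simp at h

lemma sum_neighborFinset_UC {M : Type*} [AddCommMonoid M] (hn : 2 ≤ n) (x : ZMod n)
    (f : ZMod n → M) :
    ∑ y ∈ (UC n).neighborFinset x, f y = ∑ a ∈ unitFinset n, f (x + a) := by
  refine Finset.sum_nbij' (fun y => y - x) (fun a => x + a) ?_ ?_ ?_ ?_ ?_
  · intro y hy
    rw [SimpleGraph.mem_neighborFinset, UC_adj hn] at hy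
    exact mem_unitFinset.2 hy
  · intro a ha
    rw [SimpleGraph.mem_neighborFinset, UC_adj hn, add_sub_cancel_left]
    exact mem_unitFinset.1 ha
  all_goals intros; simp

lemma isRegularOfDegree_UC (hn : 2 ≤ n) : (UC n).IsRegularOfDegree #(unitFinset n) := by
  intro x
  rw [← SimpleGraph.card_neighborFinset_eq_degree, card_eq_sum_ones, sum_neighborFinset_UC hn,
    ← card_eq_sum_ones]

lemma degree_UC_pos (hn : 2 ≤ n) (x : ZMod n) : 0 < (UC n).degree x := by
  rw [isRegularOfDegree_UC hn x]
  exact card_unitFinset_pos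

/-- The eigenvalue of the discriminant of `UC n` on the additive character `x ↦ e (c x / n)`: the
Ramanujan sum of `c`, divided by the degree `φ n`. -/
noncomputable def charEigenvalue (c : ZMod n) : ℂ :=
  (#(unitFinset n) : ℂ)⁻¹ * ∑ a ∈ unitFinset n, ZMod.stdAddChar (c * a)

lemma discriminant_mulVec_stdAddChar (hn : 2 ≤ n) (c : ZMod n) :
    discriminant (UC n) *ᵥ (fun x => ZMod.stdAddChar (c * x)) =
      charEigenvalue c • fun x => (ZMod.stdAddChar (c * x) : ℂ) := by
  ext x
  rw [discriminant_mulVec (isRegularOfDegree_UC hn), sum_neighborFinset_UC hn, charEigenvalue,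
    Pi.smul_apply, smul_eq_mul, mul_assoc, sum_mul]
  simp only [mul_add, AddChar.map_add_eq_mul, mul_comm]

/-- Perfect state transfer read off in the character basis. -/
lemma VertexTransfer.eval_charEigenvalue (hn : 2 ≤ n) {u v : ZMod n} {τ : ℕ}
    (h : VertexTransfer (UC n) u v τ) (c : ZMod n) :
    (Chebyshev.T ℂ τ).eval (charEigenvalue c) = ZMod.stdAddChar (c * (v - u)) := by
  have := h.eval_mul_eq card_unitFinset_pos (isRegularOfDegree_UC hn)
    (discriminant_mulVec_stdAddChar hn c)
  have hv : c * v = c * (v - u) + c * u := by ring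
  rw [hv, AddChar.map_add_eq_mul] at this
  exact mul_right_cancel₀ (AddChar.val_isUnit _ _).ne_zero this

lemma charEigenvalue_mul_of_isUnit (c : ZMod n) {b : ZMod n} (hb : IsUnit b) :
    charEigenvalue (c * b) = charEigenvalue c := by
  obtain ⟨b, rfl⟩ := hb
  rw [charEigenvalue, charEigenvalue]
  congr 1
  refine Finset.sum_nbij' (fun a => b * a) (fun a => ↑b⁻¹ * a) ?_ ?_ ?_ ?_ ?_
  all_goals intros; simp_all [mem_unitFinset, mul_assoc]

/-- Translation by a nilpotent element `d` permutes the units and multiplies the character sum by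
the value of the character at `d`. -/
lemma charEigenvalue_eq_zero_of_isNilpotent {c d : ZMod n} (hd : IsNilpotent d) (hcd : c * d ≠ 0) :
    charEigenvalue c = 0 := by
  have hne : (ZMod.stdAddChar (c * d) : ℂ) ≠ 1 := by
    rw [← AddChar.map_zero_eq_one (ZMod.stdAddChar (N := n))]
    exact fun h => hcd (ZMod.injective_stdAddChar h)
  have hsum : ∑ a ∈ unitFinset n, (ZMod.stdAddChar (c * a) : ℂ) =
      (∑ a ∈ unitFinset n, ZMod.stdAddChar (c * a)) * ZMod.stdAddChar (c * d) := by
    rw [sum_mul]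
    refine Finset.sum_nbij' (fun a => a - d) (fun a => a + d) ?_ ?_ ?_ ?_ ?_
    · intro a ha
      rw [mem_unitFinset] at ha ⊢
      rw [sub_eq_add_neg]
      exact hd.neg.isUnit_add_left_of_commute ha (Commute.all _ _)
    · intro a ha
      rw [mem_unitFinset] at ha ⊢
      exact hd.isUnit_add_left_of_commute ha (Commute.all _ _)
    · intros; ring
    · intros; ring
    · intro a _
      rw [← AddChar.map_add_eq_mul]
      congr 1
      ring
  rw [charEigenvalue, mul_eq_zero]
  right
  by_contra h0
  exact hne (mul_left_cancel₀ h0 (by rw [← hsum, mul_one]))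

/-- For a prime divisor `p` of `n`, the characters of order `p` all have the eigenvalue
`-1 / (p - 1)`: they are conjugate under units, and their values at a unit sum up to `-1`. -/
lemma charEigenvalue_of_prime_mul {p m : ℕ} (hp : p.Prime) (hn : n = p * m) :
    ((p : ℂ) - 1) * charEigenvalue (m : ZMod n) = -1 := by
  have : NeZero p := ⟨hp.ne_zero⟩
  have hm0 : m ≠ 0 := by rintro rfl; exact NeZero.ne n (by simpa using hn)
  have hconj : ∀ i ∈ range (p - 1),
      charEigenvalue ((m : ZMod n) * ((i + 1 : ℕ) : ZMod n)) = charEigenvalue (m : ZMod n) := by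
    intro i hi
    have hi' : i + 1 < p := by have := mem_range.1 hi; omega
    have hcop : (i + 1).Coprime p :=
      ((Nat.coprime_of_lt_prime (by omega) hi' hp).symm)
    obtain ⟨b, hb⟩ := ZMod.unitsMap_surjective (hn ▸ Dvd.intro m rfl : p ∣ n)
      (ZMod.unitOfCoprime (i + 1) hcop)
    have hb' : (((b : ZMod n).val : ℕ) : ZMod p) = ((i + 1 : ℕ) : ZMod p) := by
      have := congrArg (Units.val) hb
      rw [ZMod.unitsMap_val, ZMod.coe_unitOfCoprime] at this
      rw [← this, ZMod.natCast_val]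
    have hmod := ((ZMod.natCast_eq_natCast_iff _ _ _).1 hb').mul_left' m
    rw [mul_comm m p, ← hn, ← ZMod.natCast_eq_natCast_iff, Nat.cast_mul, Nat.cast_mul,
      ZMod.natCast_zmod_val] at hmod
    rw [← hmod, charEigenvalue_mul_of_isUnit _ b.isUnit]
  have hgeom : ∀ a ∈ unitFinset n,
      ∑ i ∈ range (p - 1), (ZMod.stdAddChar ((m : ZMod n) * ((i + 1 : ℕ) : ZMod n) * a) : ℂ) =
        -1 := by
    intro a ha
    set ζ : ℂ := ZMod.stdAddChar ((m : ZMod n) * a) with hζ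
    have hpow : ∀ i : ℕ, (ZMod.stdAddChar ((m : ZMod n) * (i : ZMod n) * a) : ℂ) = ζ ^ i := by
      intro i
      rw [hζ, ← AddChar.map_nsmul_eq_pow, nsmul_eq_mul]
      congr 1
      ring
    have hζp : ζ ^ p = 1 := by
      rw [← hpow, ← Nat.cast_mul, mul_comm m p, ← hn, ZMod.natCast_self, zero_mul,
        AddChar.map_zero_eq_one]
    have hζ1 : ζ ≠ 1 := by
      rw [hζ, ← AddChar.map_zero_eq_one (ZMod.stdAddChar (N := n))]
      intro h
      have h' := ZMod.injective_stdAddChar h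
      rw [(mem_unitFinset.1 ha).mul_left_eq_zero, ZMod.natCast_eq_zero_iff] at h'
      have hle := Nat.le_of_dvd (Nat.pos_of_ne_zero hm0) h'
      have := hp.two_le
      nlinarith [Nat.pos_of_ne_zero hm0]
    have hs : ∑ i ∈ range p, ζ ^ i = 0 := by
      rw [geom_sum_eq hζ1, hζp, sub_self, zero_div]
    obtain ⟨q, rfl⟩ : ∃ q, p = q + 1 := ⟨p - 1, by have := hp.two_le; omega⟩
    rw [sum_range_succ', pow_zero] at hs
    simp only [hpow, Nat.add_sub_cancel]
    exact eq_neg_of_add_eq_zero_left hs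
  have h1 : ∑ i ∈ range (p - 1), charEigenvalue ((m : ZMod n) * ((i + 1 : ℕ) : ZMod n)) = -1 := by
    have hk : (#(unitFinset n) : ℂ) ≠ 0 := by exact_mod_cast (card_unitFinset_pos (n := n)).ne'
    simp only [charEigenvalue]
    rw [← mul_sum, sum_comm, sum_congr rfl hgeom, sum_const, nsmul_eq_mul]
    field_simp
  rw [sum_congr rfl hconj, sum_const, card_range, nsmul_eq_mul, Nat.cast_sub hp.one_le] at h1
  simpa using h1

/-! ### Restrictions on the order of the graph -/

/-- Evaluating the eigenvalue conditions at a character and at its conjugate. -/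
lemma VertexTransfer.two_mul_sub_eq_zero (hn : 2 ≤ n) {u v : ZMod n} {τ : ℕ}
    (h : VertexTransfer (UC n) u v τ) : 2 * (v - u) = 0 := by
  have h1 := h.eval_charEigenvalue hn 1
  have h2 := h.eval_charEigenvalue hn (1 * -1)
  rw [charEigenvalue_mul_of_isUnit _ isUnit_one.neg, h1] at h2
  have := ZMod.injective_stdAddChar h2
  linear_combination this

lemma VertexTransfer.sub_ne_zero {V : Type*} [Fintype V] [DecidableEq V] [AddGroup V]
    {G : SimpleGraph V} [DecidableRel G.Adj] {u v : V} {τ : ℕ}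
    (h : VertexTransfer G u v τ) : v - u ≠ 0 := by
  intro huv
  obtain ⟨-, -, hne, -⟩ := h
  exact hne (by rw [sub_eq_zero.1 huv])

lemma VertexTransfer.stdAddChar_sub (hn : 2 ≤ n) {u v : ZMod n} {τ : ℕ}
    (h : VertexTransfer (UC n) u v τ) : (ZMod.stdAddChar (v - u) : ℂ) = -1 := by
  have hsq : (ZMod.stdAddChar (v - u) : ℂ) ^ 2 = 1 := by
    rw [← AddChar.map_nsmul_eq_pow, nsmul_eq_mul, Nat.cast_ofNat, h.two_mul_sub_eq_zero hn,
      AddChar.map_zero_eq_one]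
  refine (mul_self_eq_one_iff.1 ((pow_two _).symm.trans hsq)).resolve_left ?_
  rw [← AddChar.map_zero_eq_one (ZMod.stdAddChar (N := n))]
  exact fun h' => h.sub_ne_zero (ZMod.injective_stdAddChar h')

lemma VertexTransfer.two_dvd (hn : 2 ≤ n) {u v : ZMod n} {τ : ℕ}
    (h : VertexTransfer (UC n) u v τ) : 2 ∣ n := by
  have h2 := h.two_mul_sub_eq_zero hn
  have h0 : (v - u).val ≠ 0 := (ZMod.val_ne_zero _).2 h.sub_ne_zero
  have hlt := ZMod.val_lt (v - u)
  rw [← ZMod.natCast_zmod_val (v - u), ← Nat.cast_ofNat, ← Nat.cast_mul,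
    ZMod.natCast_eq_zero_iff] at h2
  obtain ⟨q, hq⟩ := h2
  have hq1 : q = 1 := by
    rcases q with _ | _ | q
    · omega
    · rfl
    · nlinarith
  exact ⟨(v - u).val, by rw [hq, hq1, mul_one]⟩

/-- A nilpotent `d` with `2 d ≠ 0` makes both `c = 1` and `c = 2` have the eigenvalue `0`, while the
transfer needs `T_τ` to take the value `-1` at the first and `1` at the second. -/
lemma VertexTransfer.two_mul_eq_zero_of_isNilpotent (hn : 2 ≤ n) {u v : ZMod n} {τ : ℕ}
    (h : VertexTransfer (UC n) u v τ) {d : ZMod n} (hd : IsNilpotent d) : 2 * d = 0 := by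
  by_contra h2d
  have h1 := h.eval_charEigenvalue hn 1
  have h2 := h.eval_charEigenvalue hn 2
  rw [charEigenvalue_eq_zero_of_isNilpotent hd (by rw [one_mul]; rintro rfl; simp at h2d), one_mul,
    h.stdAddChar_sub hn] at h1
  rw [charEigenvalue_eq_zero_of_isNilpotent hd h2d, h.two_mul_sub_eq_zero hn,
    AddChar.map_zero_eq_one, h1] at h2
  norm_num at h2

lemma VertexTransfer.not_eight_dvd_and_not_nine_dvd (hn : 2 ≤ n) {u v : ZMod n} {τ : ℕ}
    (h : VertexTransfer (UC n) u v τ) : ¬ 8 ∣ n ∧ ¬ 9 ∣ n := by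
  have key : ∀ d : ℕ, n ∣ d ^ 3 → n ∣ 2 * d := by
    intro d hd
    rw [← ZMod.natCast_eq_zero_iff, Nat.cast_mul, Nat.cast_ofNat]
    refine h.two_mul_eq_zero_of_isNilpotent hn ⟨3, ?_⟩
    rwa [← Nat.cast_pow, ZMod.natCast_eq_zero_iff]
  constructor
  · rintro ⟨m, rfl⟩
    have := Nat.le_of_dvd (by omega) (key (2 * m) ⟨m ^ 2, by ring⟩)
    omega
  · rintro ⟨m, rfl⟩
    have := Nat.le_of_dvd (by omega) (key (3 * m) ⟨3 * m ^ 2, by ring⟩)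
    omega

/-- The rational algebraic integer `-2 / (p - 1)` is an integer. -/
lemma VertexTransfer.prime_le_three (hn : 2 ≤ n) {u v : ZMod n} {τ : ℕ}
    (h : VertexTransfer (UC n) u v τ) {p : ℕ} (hp : p.Prime) (hpn : p ∣ n) : p ≤ 3 := by
  obtain ⟨m, hm⟩ := hpn
  have hτ : 0 < τ := h.2.2.2.1
  have hsq : (Chebyshev.T ℂ τ).eval (charEigenvalue (m : ZMod n)) ^ 2 = 1 := by
    rw [h.eval_charEigenvalue hn, ← AddChar.map_nsmul_eq_pow, nsmul_eq_mul, Nat.cast_ofNat,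
      mul_left_comm, h.two_mul_sub_eq_zero hn, mul_zero, AddChar.map_zero_eq_one]
  have hint := isIntegral_two_mul_of_T_eval_sq hτ hsq
  have hval := charEigenvalue_of_prime_mul hp hm
  have hp1 : (p : ℂ) - 1 ≠ 0 := by
    rw [_root_.sub_ne_zero]
    exact_mod_cast hp.ne_one
  obtain ⟨k, hk⟩ := hint.exists_int_iff_exists_rat.1 ⟨2 * (-1 / ((p : ℚ) - 1)), by
    rw [eq_div_of_mul_eq hp1 ((mul_comm _ _).trans hval)]
    push_cast
    rfl⟩
  have hk' : ((p : ℤ) - 1) * k = -2 := by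
    have : ((p : ℂ) - 1) * k = -2 := by linear_combination 2 * hval - ((p : ℂ) - 1) * hk
    exact_mod_cast this
  have hdvd : ((p : ℤ) - 1) ∣ 2 := (dvd_neg).1 ⟨k, hk'.symm⟩
  have := Int.le_of_dvd (by norm_num) hdvd
  omega

lemma VertexTransfer.eq_two_or_four_or_six_or_twelve (hn : 2 ≤ n) {u v : ZMod n} {τ : ℕ}
    (h : VertexTransfer (UC n) u v τ) : n = 2 ∨ n = 4 ∨ n = 6 ∨ n = 12 := by
  have h2 := h.two_dvd hn
  obtain ⟨h8, h9⟩ := h.not_eight_dvd_and_not_nine_dvd hn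
  have hp := fun (p : ℕ) (hp : p.Prime) => h.prime_le_three hn hp
  clear h
  obtain ⟨a, m, hm, hnm⟩ := Nat.exists_eq_pow_mul_and_not_dvd (NeZero.ne n) 2 (by norm_num)
  obtain ⟨b, r, hr, hmr⟩ := Nat.exists_eq_pow_mul_and_not_dvd
    (show m ≠ 0 by rintro rfl; simp at hm) 3 (by norm_num)
  have hr1 : r = 1 := by
    by_contra hr1
    obtain ⟨p, hpp, hpr⟩ := Nat.exists_prime_and_dvd hr1
    have hpm : p ∣ m := hmr ▸ hpr.mul_left _
    have hle := hp p hpp (hnm ▸ hpm.mul_left _)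
    have hge := hpp.two_le
    interval_cases p
    · exact hm hpm
    · exact hr hpr
  have ha : a < 3 := by
    by_contra ha
    exact h8 (hnm ▸ (pow_dvd_pow 2 (not_lt.1 ha)).mul_right m)
  have hb : b < 2 := by
    by_contra hb
    exact h9 (hnm ▸ hmr ▸ ((pow_dvd_pow 3 (not_lt.1 hb)).mul_right r).mul_left _)
  subst hr1 hmr hnm
  interval_cases a <;> interval_cases b <;> simp at h2 ⊢

/-! ### Transfer in the four graphs -/

/-- If the rows of `F`, divided by `c`, follow the Chebyshev recurrence for `P` from `e_0`
to `e_w`, then by translation invariance `U ^ τ` maps `d* e_u` to `d* e_(u + w)` for all `u`. -/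
lemma evolution_pow_mulVec_vertexVec_UC (hn : 2 ≤ n) {τ : ℕ} (hτ : 0 < τ) {w : ZMod n}
    {F : ℕ → ZMod n → ℤ} {c : ℤ} (hc : c ≠ 0) (h0 : F 0 = Pi.single 0 c) (hw : F τ = Pi.single w c)
    (h1 : ∀ x, ∑ a ∈ unitFinset n, F 0 (x + a) = #(unitFinset n) * F 1 x)
    (h2 : ∀ s < τ - 1, ∀ x, 2 * ∑ a ∈ unitFinset n, F (s + 1) (x + a) =
      #(unitFinset n) * (F (s + 2) x + F s x)) (u : ZMod n) :
    evolution (UC n) ^ τ *ᵥ vertexVec (UC n) u = vertexVec (UC n) (u + w) := by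
  have hk : (#(unitFinset n) : ℂ) ≠ 0 := by exact_mod_cast (card_unitFinset_pos (n := n)).ne'
  have hc' : (c : ℂ) ≠ 0 := by exact_mod_cast hc
  have hP : ∀ s x, (discriminant (UC n) *ᵥ fun x => (c : ℂ)⁻¹ * F s (x - u)) x =
      (#(unitFinset n) : ℂ)⁻¹ * (c : ℂ)⁻¹ *
        ((∑ a ∈ unitFinset n, F s (x - u + a) : ℤ) : ℂ) := by
    intro s x
    rw [discriminant_mulVec (isRegularOfDegree_UC hn), sum_neighborFinset_UC hn, ← mul_sum,
      mul_assoc, Int.cast_sum]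
    simp only [add_sub_right_comm]
  have hsingle : ∀ y : ZMod n, (fun x => (c : ℂ)⁻¹ * ((Pi.single y c : ZMod n → ℤ) (x - u) : ℂ)) =
      Pi.single (u + y) 1 := by
    intro y
    ext x
    by_cases hx : x = u + y
    · simp [hx, hc']
    · have hx' : x - u ≠ y := fun h => hx (by rw [← h]; ring)
      simp [hx, hx']
  have key := aeval_T_mulVec_of_recurrence (A := discriminant (UC n)) (τ := τ)
    (F := fun s x => (c : ℂ)⁻¹ * F s (x - u)) (fun _ => ?_) (fun s hs => ?_)
  · refine evolution_pow_mulVec_vertexVec (degree_UC_pos hn) ?_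
    simp only [h0, hw] at key
    rwa [hsingle, hsingle, add_zero] at key
  · ext x
    rw [hP, h1]
    push_cast
    field_simp
  · ext x
    have := congrArg (Int.cast (R := ℂ)) (h2 s (by omega) (x - u))
    rw [Pi.sub_apply, Pi.smul_apply, hP, smul_eq_mul]
    push_cast at this ⊢
    field_simp
    linear_combination -this

lemma vertexTransfer_of_evolution_pow (hn : 2 ≤ n) {τ : ℕ} (hτ : 0 < τ) {u v : ZMod n} (huv : u ≠ v)
    (h : evolution (UC n) ^ τ *ᵥ vertexVec (UC n) u = vertexVec (UC n) v) :
    VertexTransfer (UC n) u v τ :=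
  ⟨isState_vertexVec (degree_UC_pos hn) u, isState_vertexVec (degree_UC_pos hn) v,
    fun h' => huv (vertexVec_injective (degree_UC_pos hn) h'), hτ, 1, by simp, by rw [h, one_smul]⟩

lemma exhibitsPST_UC_iff :
    ExhibitsPST (UC n) ↔ ∃ u v τ, VertexTransfer (UC n) u v τ := by
  constructor
  · rintro ⟨_, _, ⟨-, u, rfl⟩, ⟨-, v, rfl⟩, -, τ, h⟩
    exact ⟨u, v, τ, h⟩
  · rintro ⟨u, v, τ, h⟩
    exact ⟨_, _, ⟨h.1, u, rfl⟩, ⟨h.2.1, v, rfl⟩, h.2.2.1, τ, h⟩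

end UnitaryCayley

lemma evolution_pow_one_UC_two (u : ZMod 2) :
    evolution (UC 2) ^ 1 *ᵥ vertexVec (UC 2) u = vertexVec (UC 2) (u + 1) :=
  evolution_pow_mulVec_vertexVec_UC le_rfl one_pos (c := 1)
    (F := fun s x => ![![1, 0], ![0, 1]] (Fin.ofNat 2 s) x)
    (by decide) (by decide) (by decide) (by decide) (by decide) u

lemma evolution_pow_two_UC_four (u : ZMod 4) :
    evolution (UC 4) ^ 2 *ᵥ vertexVec (UC 4) u = vertexVec (UC 4) (u + 2) :=
  evolution_pow_mulVec_vertexVec_UC (n := 4) (by norm_num) two_pos (c := 2)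
    (F := fun s x => ![![2, 0, 0, 0], ![0, 1, 0, 1], ![0, 0, 2, 0]] (Fin.ofNat 3 s) x)
    (by decide) (by decide) (by decide) (by decide) (by decide) u

lemma evolution_pow_three_UC_six (u : ZMod 6) :
    evolution (UC 6) ^ 3 *ᵥ vertexVec (UC 6) u = vertexVec (UC 6) (u + 3) :=
  evolution_pow_mulVec_vertexVec_UC (n := 6) (by norm_num) three_pos (c := 2)
    (F := fun s x => ![![2, 0, 0, 0, 0, 0], ![0, 1, 0, 0, 0, 1], ![0, 0, 1, 0, 1, 0],
      ![0, 0, 0, 2, 0, 0]] (Fin.ofNat 4 s) x)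
    (by decide) (by decide) (by decide) (by decide) (by decide) u

/-- The rows of the table are the vectors `4 T_s(P) e_0` for `s = 0, …, 6`. -/
lemma evolution_pow_six_UC_twelve (u : ZMod 12) :
    evolution (UC 12) ^ 6 *ᵥ vertexVec (UC 12) u = vertexVec (UC 12) (u + 6) :=
  evolution_pow_mulVec_vertexVec_UC (n := 12) (by norm_num) (by norm_num) (c := 4)
    (F := fun s x => ![![4, 0, 0, 0, 0, 0, 0, 0, 0, 0, 0, 0], ![0, 1, 0, 0, 0, 1, 0, 1, 0, 0, 0, 1],
      ![-2, 0, 1, 0, 1, 0, 2, 0, 1, 0, 1, 0], ![0, 0, 0, 2, 0, 0, 0, 0, 0, 2, 0, 0],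
      ![2, 0, 1, 0, 1, 0, -2, 0, 1, 0, 1, 0], ![0, 1, 0, 0, 0, 1, 0, 1, 0, 0, 0, 1],
      ![0, 0, 0, 0, 0, 0, 4, 0, 0, 0, 0, 0]] (Fin.ofNat 7 s) x)
    (by decide) (by decide) (by decide) (by decide) (by decide) u

/-- As `-1/2 = cos (2 π / 3)`, the values `T_τ(-1/2)` have period `3` in `τ`. -/
lemma T_eval_neg_half (q : ℕ) :
    (Chebyshev.T ℂ ((3 * q : ℕ) : ℤ)).eval (-1 / 2) = 1 ∧
      (Chebyshev.T ℂ ((3 * q + 1 : ℕ) : ℤ)).eval (-1 / 2) = -1 / 2 := by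
  induction q with
  | zero => simp
  | succ q ih =>
    obtain ⟨h0, h1⟩ := ih
    have e : ∀ s : ℕ, (Chebyshev.T ℂ ((s + 2 : ℕ) : ℤ)).eval (-1 / 2) =
        -(Chebyshev.T ℂ ((s + 1 : ℕ) : ℤ)).eval (-1 / 2) -
          (Chebyshev.T ℂ (s : ℤ)).eval (-1 / 2) := by
      intro s
      push_cast
      rw [Chebyshev.T_add_two]
      simp
      ring
    have h2 := e (3 * q)
    have h3 := e (3 * q + 1)
    have h4 := e (3 * q + 2)
    rw [h0, h1] at h2
    rw [h2, h1] at h3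
    rw [h3, h2] at h4
    exact ⟨by rw [mul_add, h3]; norm_num, by rw [mul_add, h4]; norm_num⟩

lemma three_dvd_of_T_eval_neg_half {τ : ℕ} (h : (Chebyshev.T ℂ τ).eval (-1 / 2) = 1) : 3 ∣ τ := by
  obtain ⟨h0, h1⟩ := T_eval_neg_half (τ / 3)
  have hlt := Nat.mod_lt τ (show 0 < 3 by norm_num)
  have hdiv := Nat.div_add_mod τ 3
  generalize τ / 3 = q at *
  generalize hr : τ % 3 = r at *
  interval_cases r
  · exact ⟨q, by omega⟩
  · rw [← hdiv, h1] at h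
    norm_num at h
  · exfalso
    have e : ((3 * q + 2 : ℕ) : ℤ) = ((3 * q : ℕ) : ℤ) + 2 := by push_cast; ring
    rw [← hdiv, e, Chebyshev.T_add_two] at h
    push_cast at h h0 h1
    simp [h0, h1] at h
    norm_num at h

lemma mod_four_of_T_eval_zero {τ : ℕ} (h : (Chebyshev.T ℂ τ).eval 0 = -1) : τ % 4 = 2 := by
  rw [Chebyshev.T_eval_zero] at h
  split_ifs at h with he
  · obtain ⟨k, hk⟩ := he
    have hk2 : (τ : ℤ) / 2 = k := by omega
    rw [hk2] at h
    rcases Int.even_or_odd k with hk' | hk'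
    · rw [Int.negOnePow_even _ hk'] at h
      norm_num at h
    · obtain ⟨j, hj⟩ := hk'
      omega
  · norm_num at h

lemma vertexTransfer_UC_twelve_iff (u v : ZMod 12) (τ : ℕ) :
    VertexTransfer (UC 12) u v τ ↔ v = u + 6 ∧ τ % 12 = 6 := by
  constructor
  · intro h
    have hn : 2 ≤ 12 := by norm_num
    have hw : v - u = 6 := by
      have h2 := h.two_mul_sub_eq_zero hn
      have h0 := h.sub_ne_zero
      generalize v - u = w at h2 h0
      revert w
      decide
    have h1 := h.eval_charEigenvalue hn 1
    have h4 := h.eval_charEigenvalue hn 4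
    rw [one_mul, h.stdAddChar_sub hn,
      charEigenvalue_eq_zero_of_isNilpotent (d := 6) ⟨2, by decide⟩ (by decide)] at h1
    have e4 : charEigenvalue (4 : ZMod 12) = -1 / 2 := by
      have := charEigenvalue_of_prime_mul (n := 12) (p := 3) (m := 4) Nat.prime_three rfl
      push_cast at this
      linear_combination (1 / 2) * this
    have hz : (4 : ZMod 12) * (v - u) = 0 := by rw [hw]; decide
    rw [e4, hz, AddChar.map_zero_eq_one] at h4
    have := mod_four_of_T_eval_zero h1
    have := three_dvd_of_T_eval_neg_half h4
    exact ⟨by rw [← hw]; ring, by omega⟩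
  · rintro ⟨rfl, hτ⟩
    refine vertexTransfer_of_evolution_pow (by norm_num) (by omega) (by revert u; decide) ?_
    have hper : evolution (UC 12) ^ 12 *ᵥ vertexVec (UC 12) u = vertexVec (UC 12) u := by
      rw [pow_add (evolution (UC 12)) 6 6, ← Matrix.mulVec_mulVec, evolution_pow_six_UC_twelve,
        evolution_pow_six_UC_twelve, add_assoc, show (6 + 6 : ZMod 12) = 0 by decide, add_zero]
    have hmul : ∀ q : ℕ,
        evolution (UC 12) ^ (12 * q) *ᵥ vertexVec (UC 12) u = vertexVec (UC 12) u := by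
      intro q
      induction q with
      | zero => simp
      | succ q ih => rw [mul_add, mul_one, pow_add, ← Matrix.mulVec_mulVec, hper, ih]
    rw [← Nat.mod_add_div τ 12, hτ, pow_add, ← Matrix.mulVec_mulVec, hmul,
      evolution_pow_six_UC_twelve]

end GroverWalk

theorem theorem4p5 :
    (∀ (n : ℕ) [NeZero n], 2 ≤ n →
      (GroverWalk.ExhibitsPST (GroverWalk.UC n) ↔ n = 2 ∨ n = 4 ∨ n = 6 ∨ n = 12)) ∧
    Nonempty (GroverWalk.UC 2 ≃g (⊤ : SimpleGraph (Fin 2))) ∧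
    Nonempty (GroverWalk.UC 4 ≃g SimpleGraph.cycleGraph 4) ∧
    Nonempty (GroverWalk.UC 6 ≃g SimpleGraph.cycleGraph 6) ∧
    (∀ (u v : ZMod 12) (τ : ℕ),
      GroverWalk.VertexTransfer (GroverWalk.UC 12) u v τ ↔ v = u + 6 ∧ τ % 12 = 6) := by
  refine ⟨fun n _ hn => ?_, ⟨Equiv.refl (Fin 2), by decide⟩, ⟨Equiv.refl (Fin 4), by decide⟩,
    ⟨Equiv.refl (Fin 6), by decide⟩, GroverWalk.vertexTransfer_UC_twelve_iff⟩
  rw [GroverWalk.exhibitsPST_UC_iff]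
  constructor
  · rintro ⟨u, v, τ, h⟩
    exact h.eq_two_or_four_or_six_or_twelve hn
  · rintro (rfl | rfl | rfl | rfl)
    · exact ⟨0, 0 + 1, 1, GroverWalk.vertexTransfer_of_evolution_pow hn one_pos (by decide)
        (GroverWalk.evolution_pow_one_UC_two 0)⟩
    · exact ⟨0, 0 + 2, 2, GroverWalk.vertexTransfer_of_evolution_pow hn two_pos (by decide)
        (GroverWalk.evolution_pow_two_UC_four 0)⟩
    · exact ⟨0, 0 + 3, 3, GroverWalk.vertexTransfer_of_evolution_pow hn three_pos (by decide)
        (GroverWalk.evolution_pow_three_UC_six 0)⟩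
    · exact ⟨0, 0 + 6, 6, (GroverWalk.vertexTransfer_UC_twelve_iff _ _ _).2 ⟨rfl, rfl⟩⟩
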